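/- Let $\chi(x)=e^{-2\pi i\,x\cdot\chi}$ denote the duality between $\mathbb R^d$ and its dual group $\mathbb R^d$; for $f\in C_c(\mathbb R^d)$ put $\tilde f(x)=\overline{f(-x)}$ and $\check f(\chi)=\int \chi(x)f(x)\,dx$. A complex Radon measure $\eta$ on $\mathbb R^d$ (not necessarily finite) is Fourier transformable if there is a complex Radon measure $\hat\eta$ on $\mathbb R^d$, its Fourier transform (which is unique), such that for all $f\in C_c(\mathbb R^d)$ one has $|\check f|^2\in L^1(|\hat\eta|)$ and $\int f*\tilde f\,d\eta=\int|\check f|^2\,d\hat\eta$. For $\Delta\subset\mathbb R^d$ and $\epsilon>0$ let $\Delta^\epsilon=\{\chi\in\mathbb R^d : |1-\chi(x)|\le\epsilon \text{ for all } x\in\Delta\}$. **Theorem 3.1.** Let $\eta$ be a Fourier transformable measure on $\mathbb R^d$ and let $\Delta\subset\mathbb R^d$ be a set with $\operatorname{supp}(\eta)\subset\Delta$. Then there is a constant $C\ge 0$ such that for all $\epsilon>0$, all $\chi\in\mathbb R^d$ and all $\psi\in\Delta^\epsilon$, $$|\hat\eta(\{\psi+\chi\})-\hat\eta(\{\chi\})|\le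 C\epsilon .$$ Moreover, if $\eta$ is positive, then $\hat\eta(\{0\})\ge 0$ and this holds with $C=\hat\eta(\{0\})$. -/

import Mathlib

open MeasureTheory
open scoped FourierTransform Convolution ComplexConjugate

/-- A complex Radon measure `μ` on a locally compact, second countable space (not necessarily
finite), given by its polar form `μ = h |μ|`: the total variation measure `|μ|` is a locally
finite positive Borel measure and the phase `h` is a Borel function with `|h| = 1`. -/
structure ComplexRadonMeasure (E : Type*) [TopologicalSpace E] [MeasurableSpace E] where
  /-- the total variation measure `|μ|` -/
  variation : Measure E
  /-- the density of `μ` with respect to `|μ|` -/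
  phase : E → ℂ
  locallyFinite : IsLocallyFiniteMeasure variation
  measurable_phase : Measurable phase
  norm_phase : ∀ x, ‖phase x‖ = 1

namespace ComplexRadonMeasure

variable {E : Type*} [TopologicalSpace E] [MeasurableSpace E]

/-- The integral `∫ f dμ = ∫ f h d|μ|`, meaningful for `f ∈ L¹(|μ|)`. -/
noncomputable def integral (μ : ComplexRadonMeasure E) (f : E → ℂ) : ℂ :=
  ∫ x, f x * μ.phase x ∂μ.variation

/-- The value `μ(B) = ∫_B h d|μ|`, meaningful for relatively compact Borel sets `B`. -/
noncomputable def measureOf (μ : ComplexRadonMeasure E) (B : Set E) : ℂ :=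
  ∫ x in B, μ.phase x ∂μ.variation

/-- The support of `μ`, which is the support of `|μ|`. -/
def supp (μ : ComplexRadonMeasure E) : Set E :=
  μ.variation.support

/-- `μ` is positive: `μ = |μ|`. -/
def IsPositive (μ : ComplexRadonMeasure E) : Prop :=
  ∀ᵐ x ∂μ.variation, μ.phase x = 1

end ComplexRadonMeasure

/-- The duality `⟨χ, x⟩ = χ(x) = e^{-2πi x·χ}` between `ℝ^d` and its dual group `ℝ^d`. -/
noncomputable def dualChar {d : ℕ} (χ x : EuclideanSpace ℝ (Fin d)) : ℂ :=
  Complex.exp (-2 * Real.pi * Complex.I * (inner ℝ x χ : ℝ))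

/-- The `ε`-dual set `Δ^ε` of all `χ` with `|1 - χ(x)| ≤ ε` for every `x ∈ Δ`. -/
def epsDual {d : ℕ} (Δ : Set (EuclideanSpace ℝ (Fin d))) (ε : ℝ) :
    Set (EuclideanSpace ℝ (Fin d)) :=
  {χ | ∀ x ∈ Δ, ‖1 - dualChar χ x‖ ≤ ε}

/-- The convolution `f * f~` with `f~(x) = conj (f (-x))`. -/
noncomputable def autoConv {d : ℕ} (f : EuclideanSpace ℝ (Fin d) → ℂ) :
    EuclideanSpace ℝ (Fin d) → ℂ :=
  f ⋆[ContinuousLinearMap.mul ℝ ℂ, volume] (fun x => conj (f (-x)))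

/-- `ν` is the Fourier transform of `η` (so `η` is Fourier transformable): for every continuous
compactly supported `f`, `|f^∨|²` is `|ν|`-integrable and `∫ f * f~ dη = ∫ |f^∨|² dν`, where
`f^∨(χ) = ∫ χ(x) f(x) dx` is the inverse Fourier transform. As `χ(x) = e^{-2πi x·χ}`, the function
`f^∨` is Mathlib's `𝓕 f`. -/
def IsFourierTransform {d : ℕ} (η ν : ComplexRadonMeasure (EuclideanSpace ℝ (Fin d))) : Prop :=
  ∀ f : EuclideanSpace ℝ (Fin d) → ℂ, Continuous f → HasCompactSupport f →
    Integrable (fun χ => ‖𝓕 f χ‖ ^ 2) ν.variation ∧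
      η.integral (autoConv f) = ν.integral (fun χ => ((‖𝓕 f χ‖ ^ 2 : ℝ) : ℂ))

/-! ### Unitary characters -/

section Characters

variable {V : Type*} [NormedAddCommGroup V] [InnerProductSpace ℝ V]

/-! Write `e_ξ` for the characters and `ν` for the transform of `η`. Testing the defining identity
with modulated, widely dilated bumps gives weights `F n` for which `∫ e_ξ F n dη` is the integral
against `ν` of a nonnegative function equal to 1 at `ξ` and shrinking onto `{ξ}`; so it tends to
`ν({ξ})`. Dominated convergence, and a bound `S` uniform in `n` and `ξ`, come from
translation-boundedness of `|ν|`, which follows from the closed graph theorem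
(`exists_integral_norm_fourier_sub_sq_le`, `exists_integral_one_add_norm_sub_le`).

The difference of two atoms is then the limit of `∫ (e_ψ - 1) e_χ F n dη`, where `|e_ψ - 1| ≤ ε` on
the support. If `η` is positive, `F n ≥ 0` makes the total mass `∫ F n dη → ν({0})`, and the
estimate is immediate.

In general `∫ |F n| d|η|` is not controlled; only the sup norm `S` of the transform of `F n η` is.
The Bernstein-type estimate `norm_integral_unitaryChar_sub_one_mul_le` uses this alone: on the
support `e_ψ - 1` agrees with `exp(c T) - 1`, with `T` a triangle wave in `N x·ψ`, `N` about `1/ε`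
and `|c|` of order `ε`. Since `T` has an absolutely summable Fourier series, multiplication by it is
bounded in that sup norm, and the exponential series yields a factor of order `ε`. -/

/-- The unitary character `x ↦ e^{2πi x·ξ}`. -/
noncomputable def unitaryChar (ξ x : V) : ℂ :=
  Complex.exp (2 * Real.pi * Complex.I * (inner ℝ x ξ : ℝ))

lemma unitaryChar_zero (x : V) : unitaryChar 0 x = 1 := by
  simp [unitaryChar]

lemma unitaryChar_add (ξ ζ x : V) :
    unitaryChar (ξ + ζ) x = unitaryChar ξ x * unitaryChar ζ x := by
  simp only [unitaryChar, inner_add_right, ← Complex.exp_add]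
  push_cast
  ring_nf

lemma norm_unitaryChar (ξ x : V) : ‖unitaryChar ξ x‖ = 1 := by
  rw [unitaryChar, Complex.norm_exp]
  simp

lemma continuous_unitaryChar (ξ : V) : Continuous (unitaryChar ξ) := by
  unfold unitaryChar
  fun_prop

lemma conj_unitaryChar (ξ x : V) : conj (unitaryChar ξ x) = unitaryChar (-ξ) x := by
  rw [unitaryChar, unitaryChar, ← Complex.exp_conj]
  simp [map_ofNat]

lemma unitaryChar_sub_right (ξ x y : V) :
    unitaryChar ξ (x - y) = unitaryChar ξ x * conj (unitaryChar ξ y) := by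
  rw [conj_unitaryChar]
  simp only [unitaryChar, inner_sub_left, inner_neg_right, ← Complex.exp_add]
  push_cast
  ring_nf

lemma cos_smul_inner_eq (n : ℝ) (c : ℝ) (ψ x : V) :
    ((Real.cos (2 * Real.pi * n * (c - inner ℝ x ψ)) : ℝ) : ℂ) =
      (Complex.exp (2 * Real.pi * n * c * Complex.I) * unitaryChar (-(n • ψ)) x +
        Complex.exp (-(2 * Real.pi * n * c * Complex.I)) * unitaryChar (n • ψ) x) / 2 := by
  simp only [unitaryChar, inner_neg_right, inner_smul_right, ← Complex.exp_add]
  rw [Complex.ofReal_cos, Complex.cos]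
  push_cast
  ring_nf

end Characters

/-! ### A triangle wave with absolutely summable Fourier coefficients -/

section TriangleWave

/-- A triangle wave of period one, given by its Fourier series. -/
noncomputable def triangleWave (u : ℝ) : ℝ :=
  ∑' n : ℕ, 1 / (n : ℝ) ^ 2 *
    (Real.cos (2 * Real.pi * n * (1 / 4 - u)) - Real.cos (2 * Real.pi * n * (3 / 4 - u)))

lemma triangleWave_term_le (n : ℕ) (u : ℝ) :
    ‖1 / (n : ℝ) ^ 2 * (Real.cos (2 * Real.pi * n * (1 / 4 - u)) -
      Real.cos (2 * Real.pi * n * (3 / 4 - u)))‖ ≤ 2 * (1 / (n : ℝ) ^ 2) := by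
  rw [norm_mul, Real.norm_of_nonneg (by positivity), mul_comm]
  gcongr
  refine (norm_sub_le _ _).trans ?_
  have h1 := Real.abs_cos_le_one (2 * Real.pi * n * (1 / 4 - u))
  have h2 := Real.abs_cos_le_one (2 * Real.pi * n * (3 / 4 - u))
  simp only [Real.norm_eq_abs]
  linarith

/-- This is `2 ζ(2)`; the term `n = 0` vanishes because `1 / 0 = 0`. -/
lemma hasSum_triangleWave_bound :
    HasSum (fun n : ℕ => 2 * (1 / (n : ℝ) ^ 2)) (Real.pi ^ 2 / 3) := by
  have h := hasSum_zeta_two.mul_left (2 : ℝ)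
  rwa [show 2 * (Real.pi ^ 2 / 6) = Real.pi ^ 2 / 3 by ring] at h

lemma summable_triangleWave (u : ℝ) :
    Summable fun n : ℕ => 1 / (n : ℝ) ^ 2 *
      (Real.cos (2 * Real.pi * n * (1 / 4 - u)) - Real.cos (2 * Real.pi * n * (3 / 4 - u))) :=
  Summable.of_norm_bounded hasSum_triangleWave_bound.summable (triangleWave_term_le · u)

lemma abs_triangleWave_le (u : ℝ) : |triangleWave u| ≤ Real.pi ^ 2 / 3 :=
  tsum_of_norm_bounded hasSum_triangleWave_bound (triangleWave_term_le · u)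

lemma continuous_triangleWave : Continuous triangleWave :=
  continuous_tsum (fun n => by fun_prop) hasSum_triangleWave_bound.summable triangleWave_term_le

/-- The cosine series of the Bernoulli polynomial `B₂` on `[0, 1]` gives `π² (B₂(1/4 - u) - B₂(3/4 -
u))`, in which the quadratic terms cancel. The restriction on `u` keeps both arguments in `[0, 1]`.
-/
lemma triangleWave_eq_of_abs_le {u : ℝ} (hu : |u| ≤ 1 / 4) :
    triangleWave u = Real.pi ^ 2 * u := by
  obtain ⟨h1, h2⟩ := abs_le.1 hu
  have e : ∀ x : ℝ, (Polynomial.map (algebraMap ℚ ℝ) (Polynomial.bernoulli (2 * 1))).eval x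
      = x ^ 2 - x + 1 / 6 := by
    intro x
    simp [Polynomial.bernoulli_def, Finset.sum_range_succ, bernoulli_two]
    ring
  have a := hasSum_one_div_nat_pow_mul_cos one_ne_zero (x := 1 / 4 - u)
    ⟨by linarith, by linarith⟩
  have b := hasSum_one_div_nat_pow_mul_cos one_ne_zero (x := 3 / 4 - u)
    ⟨by linarith, by linarith⟩
  rw [e] at a b
  have c := a.sub b
  simp only [← mul_sub, mul_one] at c
  rw [triangleWave, c.tsum_eq]
  norm_num [Nat.factorial]
  ring

lemma triangleWave_add_int (u : ℝ) (j : ℤ) : triangleWave (u + j) = triangleWave u := by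
  unfold triangleWave
  congr 1 with n
  have h : ∀ c : ℝ, Real.cos (2 * Real.pi * n * (c - (u + j))) =
      Real.cos (2 * Real.pi * n * (c - u)) := by
    intro c
    rw [← Real.cos_sub_int_mul_two_pi (2 * Real.pi * n * (c - u)) (n * j)]
    congr 1
    push_cast
    ring
  rw [h, h]

end TriangleWave

/-! ### Bernstein inequality for weights with bounded Fourier transform -/

section Bernstein

variable {V : Type*} [NormedAddCommGroup V] [InnerProductSpace ℝ V] [MeasurableSpace V]
  [BorelSpace V]

lemma integrable_unitaryChar_mul {m : Measure V} {w : V → ℂ} (hw : Integrable w m) (ξ : V) :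
    Integrable (fun x => unitaryChar ξ x * w x) m :=
  hw.bdd_mul (c := 1) (continuous_unitaryChar ξ).aestronglyMeasurable
    (ae_of_all _ fun x => (norm_unitaryChar ξ x).le)

/-- The cosine is a mean of two characters with unimodular coefficients, and these only shift the
frequency `ξ`, over which `S` is uniform. -/
lemma norm_integral_cos_mul_le {m : Measure V} {w : V → ℂ} (hw : Integrable w m) {S : ℝ}
    (hS : ∀ ξ, ‖∫ x, unitaryChar ξ x * w x ∂m‖ ≤ S) (n c : ℝ) (ψ ξ : V) :
    ‖∫ x, ((Real.cos (2 * Real.pi * n * (c - inner ℝ x ψ)) : ℝ) : ℂ) *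
      (unitaryChar ξ x * w x) ∂m‖ ≤ S := by
  have e : ∀ x, ((Real.cos (2 * Real.pi * n * (c - inner ℝ x ψ)) : ℝ) : ℂ) *
      (unitaryChar ξ x * w x) =
      Complex.exp ((2 * Real.pi * n * c : ℝ) * Complex.I) / 2 *
        (unitaryChar (-(n • ψ) + ξ) x * w x) +
      Complex.exp ((-(2 * Real.pi * n * c) : ℝ) * Complex.I) / 2 *
        (unitaryChar (n • ψ + ξ) x * w x) := by
    intro x
    rw [cos_smul_inner_eq, unitaryChar_add, unitaryChar_add]
    push_cast
    ring_nf
  simp_rw [e]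
  rw [integral_add ((integrable_unitaryChar_mul hw _).const_mul _)
    ((integrable_unitaryChar_mul hw _).const_mul _), integral_const_mul, integral_const_mul]
  refine (norm_add_le _ _).trans ?_
  rw [norm_mul, norm_mul, norm_div, norm_div, Complex.norm_exp_ofReal_mul_I,
    Complex.norm_exp_ofReal_mul_I]
  have h1 := hS (-(n • ψ) + ξ)
  have h2 := hS (n • ψ + ξ)
  norm_num
  linarith

lemma norm_integral_triangleWave_mul_le {m : Measure V} {w : V → ℂ} (hw : Integrable w m) {S : ℝ}
    (hS : ∀ ξ, ‖∫ x, unitaryChar ξ x * w x ∂m‖ ≤ S) (ψ ξ : V) :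
    ‖∫ x, (triangleWave (inner ℝ x ψ) : ℂ) * (unitaryChar ξ x * w x) ∂m‖
      ≤ Real.pi ^ 2 / 3 * S := by
  have hw' := integrable_unitaryChar_mul hw ξ
  let F : ℕ → V → ℂ := fun n x => ((1 / (n : ℝ) ^ 2 *
      (Real.cos (2 * Real.pi * n * (1 / 4 - inner ℝ x ψ)) -
        Real.cos (2 * Real.pi * n * (3 / 4 - inner ℝ x ψ))) : ℝ) : ℂ) * (unitaryChar ξ x * w x)
  have hcos : ∀ (n c : ℝ), Integrable (fun x =>
      ((Real.cos (2 * Real.pi * n * (c - inner ℝ x ψ)) : ℝ) : ℂ) * (unitaryChar ξ x * w x)) m := by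
    intro n c
    refine hw'.bdd_mul (c := 1) (Continuous.aestronglyMeasurable (by fun_prop))
      (ae_of_all _ fun x => ?_)
    rw [Complex.norm_real]
    exact Real.abs_cos_le_one _
  have hsum : HasSum (fun n => ∫ x, F n x ∂m)
      (∫ x, (triangleWave (inner ℝ x ψ) : ℂ) * (unitaryChar ξ x * w x) ∂m) := by
    refine hasSum_integral_of_dominated_convergence
      (fun n x => 2 * (1 / (n : ℝ) ^ 2) * ‖unitaryChar ξ x * w x‖) (fun n => ?_)
      (fun n => ae_of_all _ fun x => ?_) (ae_of_all _ fun x => ?_) ?_ (ae_of_all _ fun x => ?_)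
    · exact (Continuous.aestronglyMeasurable (by fun_prop)).mul hw'.1
    · rw [norm_mul, Complex.norm_real]
      gcongr
      exact triangleWave_term_le n _
    · exact hasSum_triangleWave_bound.summable.mul_right _
    · simp_rw [tsum_mul_right]
      exact hw'.norm.const_mul _
    · exact (Complex.hasSum_ofReal.2 (summable_triangleWave _).hasSum).mul_right _
  rw [← hsum.tsum_eq]
  refine tsum_of_norm_bounded (hasSum_triangleWave_bound.mul_right S) fun n => ?_
  have e : ∀ x, F n x = ((1 / (n : ℝ) ^ 2 : ℝ) : ℂ) *
      (((Real.cos (2 * Real.pi * n * (1 / 4 - inner ℝ x ψ)) : ℝ) : ℂ) * (unitaryChar ξ x * w x) -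
      ((Real.cos (2 * Real.pi * n * (3 / 4 - inner ℝ x ψ)) : ℝ) : ℂ) *
        (unitaryChar ξ x * w x)) := by
    intro x
    simp only [F]
    push_cast
    ring
  simp_rw [e]
  rw [integral_const_mul, integral_sub (hcos _ _) (hcos _ _), norm_mul, Complex.norm_real,
    Real.norm_of_nonneg (by positivity),
    show 2 * (1 / (n : ℝ) ^ 2) * S = 1 / (n : ℝ) ^ 2 * (2 * S) by ring]
  refine mul_le_mul_of_nonneg_left ?_ (by positivity)
  refine (norm_sub_le _ _).trans ?_
  have h1 := norm_integral_cos_mul_le hw hS n (1 / 4) ψ ξ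
  have h2 := norm_integral_cos_mul_le hw hS n (3 / 4) ψ ξ
  linarith

/-- The triangle-wave bound holds at every frequency, so it can be iterated: each factor is absorbed
into `w` and enlarges `S`. -/
lemma norm_integral_pow_mul_le {m : Measure V} {w : V → ℂ} (hw : Integrable w m) {S : ℝ}
    (hS : ∀ ξ, ‖∫ x, unitaryChar ξ x * w x ∂m‖ ≤ S) (c : ℂ) (ψ : V) (k : ℕ) (ξ : V) :
    ‖∫ x, unitaryChar ξ x * ((c * triangleWave (inner ℝ x ψ)) ^ k * w x) ∂m‖
      ≤ (‖c‖ * (Real.pi ^ 2 / 3)) ^ k * S := by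
  induction k generalizing w S ξ with
  | zero => simpa using hS ξ
  | succ k ih =>
    have hw1 : Integrable (fun x => c * triangleWave (inner ℝ x ψ) * w x) m := by
      refine hw.bdd_mul (c := ‖c‖ * (Real.pi ^ 2 / 3))
        (Continuous.aestronglyMeasurable ?_) (ae_of_all _ fun x => ?_)
      · have := continuous_triangleWave
        fun_prop
      · rw [norm_mul, Complex.norm_real]
        gcongr
        exact abs_triangleWave_le _
    have h := ih hw1 (S := ‖c‖ * (Real.pi ^ 2 / 3) * S) (fun ζ => ?_) ξ
    · convert h using 1
      · congr 2 with x
        ring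
      · ring
    · have e : ∀ x, unitaryChar ζ x * (c * triangleWave (inner ℝ x ψ) * w x) =
          c * (triangleWave (inner ℝ x ψ) * (unitaryChar ζ x * w x)) := fun x => by ring
      simp_rw [e]
      rw [integral_const_mul, norm_mul, mul_assoc]
      gcongr
      exact norm_integral_triangleWave_mul_le hw hS ψ ζ

/-- Expand the exponential and sum the bounds on powers. Dropping the constant term is what makes
the result small for small `c`. -/
lemma norm_integral_exp_sub_one_mul_le {m : Measure V} {w : V → ℂ} (hw : Integrable w m) {S : ℝ}
    (hS : ∀ ξ, ‖∫ x, unitaryChar ξ x * w x ∂m‖ ≤ S) (c : ℂ) (ψ ξ : V) :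
    ‖∫ x, (Complex.exp (c * triangleWave (inner ℝ x ψ)) - 1) * (unitaryChar ξ x * w x) ∂m‖
      ≤ (Real.exp (‖c‖ * (Real.pi ^ 2 / 3)) - 1) * S := by
  have hw' := integrable_unitaryChar_mul hw ξ
  set b : ℝ := ‖c‖ * (Real.pi ^ 2 / 3) with hb
  have hT := continuous_triangleWave
  have hexp : HasSum (fun k : ℕ => b ^ (k + 1) / (k + 1).factorial) (Real.exp b - 1) := by
    have h := NormedSpace.expSeries_div_hasSum_exp (𝔸 := ℝ) b
    rw [← Real.exp_eq_exp_ℝ, ← hasSum_nat_add_iff' 1] at h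
    simpa using h
  have hcexp : ∀ z : ℂ,
      HasSum (fun k : ℕ => z ^ (k + 1) / (k + 1).factorial) (Complex.exp z - 1) := by
    intro z
    have h := NormedSpace.expSeries_div_hasSum_exp (𝔸 := ℂ) z
    rw [← Complex.exp_eq_exp_ℂ, ← hasSum_nat_add_iff' 1] at h
    simpa using h
  have hsum : HasSum (fun k : ℕ => ∫ x, (c * triangleWave (inner ℝ x ψ)) ^ (k + 1) /
      (k + 1).factorial * (unitaryChar ξ x * w x) ∂m)
      (∫ x, (Complex.exp (c * triangleWave (inner ℝ x ψ)) - 1) * (unitaryChar ξ x * w x) ∂m) := by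
    refine hasSum_integral_of_dominated_convergence
      (fun k x => b ^ (k + 1) / (k + 1).factorial * ‖unitaryChar ξ x * w x‖) (fun k => ?_)
      (fun k => ae_of_all _ fun x => ?_) (ae_of_all _ fun x => ?_) ?_ (ae_of_all _ fun x => ?_)
    · exact (Continuous.aestronglyMeasurable (by fun_prop)).mul hw'.1
    · rw [norm_mul, norm_div, norm_pow, norm_mul, Complex.norm_real, Complex.norm_natCast]
      gcongr
      exact mul_le_mul_of_nonneg_left (abs_triangleWave_le _) (norm_nonneg _)
    · exact hexp.summable.mul_right _
    · simp_rw [tsum_mul_right]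
      exact hw'.norm.const_mul _
    · exact (hcexp _).mul_right _
  rw [← hsum.tsum_eq]
  refine tsum_of_norm_bounded (hexp.mul_right S) fun k => ?_
  have e : ∀ x, (c * triangleWave (inner ℝ x ψ)) ^ (k + 1) /
      (k + 1).factorial * (unitaryChar ξ x * w x) = ((k + 1).factorial : ℂ)⁻¹ *
      (unitaryChar ξ x * ((c * triangleWave (inner ℝ x ψ)) ^ (k + 1) * w x)) := by
    intro x
    ring
  simp_rw [e]
  rw [integral_const_mul, norm_mul, norm_inv, Complex.norm_natCast, div_eq_inv_mul, mul_assoc]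
  gcongr
  exact norm_integral_pow_mul_le hw hS c ψ (k + 1) ξ

/-- With `t` the signed distance to the nearest integer, the right side is `2 |sin(π t)|`, and
Jordan's inequality applies. -/
lemma exists_int_abs_sub_le_norm_exp_sub_one (v : ℝ) :
    ∃ j : ℤ, 4 * |v - j| ≤ ‖Complex.exp (2 * Real.pi * Complex.I * v) - 1‖ := by
  refine ⟨round v, ?_⟩
  set t := v - round v with ht
  have h2 : |t| ≤ 1 / 2 := abs_sub_round v
  have e : Complex.exp (2 * Real.pi * Complex.I * v) =
      Complex.exp (Complex.I * (2 * Real.pi * t : ℝ)) := by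
    rw [Complex.exp_eq_exp_iff_exists_int]
    refine ⟨round v, ?_⟩
    rw [ht]
    push_cast
    ring
  rw [e, Complex.norm_exp_I_mul_ofReal_sub_one, norm_mul, Real.norm_ofNat, Real.norm_eq_abs]
  have h3 := Real.mul_abs_le_abs_sin (x := Real.pi * t) (by
    rw [abs_mul, abs_of_pos Real.pi_pos]; nlinarith [Real.pi_pos])
  rw [abs_mul, abs_of_pos Real.pi_pos] at h3
  have h4 : 2 / Real.pi * (Real.pi * |t|) = 2 * |t| := by
    field_simp
  rw [show 2 * Real.pi * t / 2 = Real.pi * t by ring]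
  linarith

/-- A Bernstein inequality: if `|∫ e_ξ w|` is at most `S` for all characters `e_ξ` and the
character `e_ψ` is `ε`-close to one where `w` lives, then multiplication of `w` by `e_ψ - 1` gains
a factor of order `ε`. -/
lemma norm_integral_unitaryChar_sub_one_mul_le {m : Measure V} {w : V → ℂ} (hw : Integrable w m)
    {S : ℝ} (hS : ∀ ξ, ‖∫ x, unitaryChar ξ x * w x ∂m‖ ≤ S) {ε : ℝ} (hε : 0 < ε) (ψ : V)
    (hψ : ∀ᵐ x ∂m, ‖unitaryChar ψ x - 1‖ ≤ ε) (ξ : V) :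
    ‖∫ x, (unitaryChar ψ x - 1) * (unitaryChar ξ x * w x) ∂m‖
      ≤ 2 * (Real.exp 8 - 1) * S * ε := by
  have hS0 : 0 ≤ S := (norm_nonneg _).trans (hS 0)
  have hexp8 : 9 ≤ Real.exp 8 := by
    have := Real.add_one_le_exp (8 : ℝ)
    linarith
  -- For `ε > 1` the trivial bound `2 S` suffices.
  rcases lt_or_ge 1 ε with h1 | h1
  · have e : ∀ x, (unitaryChar ψ x - 1) * (unitaryChar ξ x * w x) =
        unitaryChar (ψ + ξ) x * w x - unitaryChar ξ x * w x := by
      intro x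
      rw [unitaryChar_add]
      ring
    simp_rw [e]
    rw [integral_sub (integrable_unitaryChar_mul hw _) (integrable_unitaryChar_mul hw _)]
    refine (norm_sub_le _ _).trans ?_
    have h2 := hS (ψ + ξ)
    have h3 := hS ξ
    have h4 : S ≤ S * ε := le_mul_of_one_le_right hS0 h1.le
    nlinarith [mul_nonneg hS0 hε.le]
  -- `N ε ≤ 1` keeps the argument of the wave in its linear range modulo integers; `1 ≤ 2 N ε` makes
  -- `1 / N` of order `ε`.
  · obtain ⟨N, hN1, hN2, hN0⟩ : ∃ N : ℕ, N * ε ≤ 1 ∧ 1 ≤ 2 * N * ε ∧ 0 < N := by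
      have h2 : 1 ≤ ⌊1 / ε⌋₊ := Nat.le_floor (by rw [le_div_iff₀ hε]; simpa using h1)
      have h2' : (1 : ℝ) ≤ (⌊1 / ε⌋₊ : ℝ) := by exact_mod_cast h2
      have h3 : (⌊1 / ε⌋₊ : ℝ) ≤ 1 / ε := Nat.floor_le (by positivity)
      have h4 : 1 / ε < ⌊1 / ε⌋₊ + 1 := Nat.lt_floor_add_one _
      refine ⟨⌊1 / ε⌋₊, ?_, ?_, h2⟩
      · rwa [le_div_iff₀ hε] at h3
      · rw [div_lt_iff₀ hε] at h4
        nlinarith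
    have hNpos : (0 : ℝ) < N := by exact_mod_cast hN0
    have hpi := Real.pi_pos
    -- Chosen so that slope `π²` and dilation `N` combine to `2πi`: on the linear range `c T = 2πi
    -- (x·ψ - j)`.
    set c : ℂ := ((2 / (Real.pi * N) : ℝ) : ℂ) * Complex.I with hc
    have key : ∀ᵐ x ∂m, (unitaryChar ψ x - 1) * (unitaryChar ξ x * w x) =
        (Complex.exp (c * triangleWave (inner ℝ x ((N : ℝ) • ψ))) - 1) *
          (unitaryChar ξ x * w x) := by
      filter_upwards [hψ] with x hx
      congr 2
      obtain ⟨j, hj⟩ := exists_int_abs_sub_le_norm_exp_sub_one (inner ℝ x ψ)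
      have hj' : 4 * |inner ℝ x ψ - j| ≤ ε := hj.trans hx
      rw [inner_smul_right]
      have e1 : (N : ℝ) * inner ℝ x ψ = N * (inner ℝ x ψ - j) + ((N * j : ℤ) : ℝ) := by
        push_cast
        ring
      rw [e1, triangleWave_add_int, triangleWave_eq_of_abs_le]
      · rw [unitaryChar, Complex.exp_eq_exp_iff_exists_int]
        refine ⟨j, ?_⟩
        rw [hc]
        have hpi' : (Real.pi : ℂ) ≠ 0 := by exact_mod_cast hpi.ne'
        have hN' : (N : ℂ) ≠ 0 := by exact_mod_cast hN0.ne'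
        push_cast
        field_simp
        ring
      · rw [abs_mul, Nat.abs_cast]
        nlinarith
    rw [integral_congr_ae key]
    refine (norm_integral_exp_sub_one_mul_le hw hS c _ ξ).trans ?_
    have hcn : ‖c‖ * (Real.pi ^ 2 / 3) = 2 * Real.pi / 3 * (1 / N) := by
      rw [hc, norm_mul, Complex.norm_I, Complex.norm_real, Real.norm_of_nonneg (by positivity)]
      field_simp
    have hN3 : 1 / (N : ℝ) ≤ 2 * ε := by
      rw [div_le_iff₀ hNpos]
      linarith
    have hN4 : 1 / (N : ℝ) ≤ 1 := by
      rw [div_le_one hNpos]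
      exact_mod_cast hN0
    have hN5 : 0 < 1 / (N : ℝ) := by positivity
    -- Convexity of `exp` between 0 and 8; the 8 is a generous bound for `2π/3`.
    have hconv : Real.exp (8 * (1 / (N : ℝ))) ≤ 1 + (1 / (N : ℝ)) * (Real.exp 8 - 1) := by
      have := convexOn_exp.2 (Set.mem_univ (8 : ℝ)) (Set.mem_univ (0 : ℝ)) hN5.le
        (sub_nonneg.2 hN4) (by ring)
      simp only [smul_eq_mul, mul_zero, add_zero, Real.exp_zero, mul_one] at this
      rw [mul_comm (8 : ℝ)]
      linarith
    have hle : Real.exp (‖c‖ * (Real.pi ^ 2 / 3)) ≤ Real.exp (8 * (1 / (N : ℝ))) := by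
      rw [hcn]
      gcongr
      linarith [Real.pi_le_four]
    calc (Real.exp (‖c‖ * (Real.pi ^ 2 / 3)) - 1) * S
        ≤ (2 * ε * (Real.exp 8 - 1)) * S := by
          gcongr
          have : (1 / (N : ℝ)) * (Real.exp 8 - 1) ≤ 2 * ε * (Real.exp 8 - 1) := by
            gcongr
            linarith
          linarith
      _ = _ := by ring

end Bernstein

/-! ### Translation-boundedness of the transform -/

section TranslationBounded

open Filter Topology

/-- The bounded continuous functions that vanish outside `K`. -/
def boundedSupportedIn {V : Type*} [NormedAddCommGroup V] (K : Set V) : Submodule ℂ (BoundedContinuousFunction V ℂ) where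
  carrier := {f | ∀ x ∉ K, f x = 0}
  add_mem' hf hg x hx := by simp [hf x hx, hg x hx]
  zero_mem' x _ := rfl
  smul_mem' c f hf x hx := by simp [hf x hx]

lemma isClosed_boundedSupportedIn {V : Type*} [NormedAddCommGroup V] (K : Set V) :
    IsClosed (boundedSupportedIn K : Set (BoundedContinuousFunction V ℂ)) := by
  have e : (boundedSupportedIn K : Set (BoundedContinuousFunction V ℂ)) =
      ⋂ x ∈ Kᶜ, {f | f x = 0} := by
    ext f
    simp only [Set.mem_iInter, Set.mem_compl_iff, Set.mem_ofPred_eq]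
    rfl
  rw [e]
  exact isClosed_biInter fun x _ =>
    isClosed_eq (BoundedContinuousFunction.evalCLM ℂ x).continuous continuous_const

lemma hasCompactSupport_of_mem_boundedSupportedIn {V : Type*} [NormedAddCommGroup V]
    {K : Set V} (hK : IsCompact K)
    {f : BoundedContinuousFunction V ℂ} (hf : f ∈ boundedSupportedIn K) : HasCompactSupport f :=
  HasCompactSupport.intro hK fun x hx => hf x hx

variable {V : Type*} [NormedAddCommGroup V] [InnerProductSpace ℝ V] [MeasurableSpace V]
  [BorelSpace V] [FiniteDimensional ℝ V]

lemma fourier_eq_integral_unitaryChar (f : V → ℂ) (χ : V) :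
    𝓕 f χ = ∫ x, unitaryChar (-χ) x * f x := by
  rw [Real.fourier_eq']
  congr 1 with x
  rw [unitaryChar, smul_eq_mul, inner_neg_right]
  push_cast
  ring_nf

lemma fourier_unitaryChar_mul (f : V → ℂ) (ξ χ : V) :
    𝓕 (fun x => unitaryChar ξ x * f x) χ = 𝓕 f (χ - ξ) := by
  rw [fourier_eq_integral_unitaryChar, fourier_eq_integral_unitaryChar]
  congr 1 with x
  rw [neg_sub, sub_eq_add_neg, unitaryChar_add]
  ring

lemma continuous_fourier_of_integrable {f : V → ℂ} (hf : Integrable f) : Continuous (𝓕 f) :=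
  VectorFourier.fourierIntegral_continuous Real.continuous_fourierChar
    (by exact continuous_inner) hf

lemma norm_fourier_sub_le {f g : V → ℂ} (hf : Integrable f) (hg : Integrable g) (χ : V) :
    ‖𝓕 f χ - 𝓕 g χ‖ ≤ ∫ x, ‖f x - g x‖ := by
  rw [fourier_eq_integral_unitaryChar, fourier_eq_integral_unitaryChar,
    ← integral_sub (integrable_unitaryChar_mul hf _) (integrable_unitaryChar_mul hg _)]
  refine (norm_integral_le_integral_norm _).trans_eq ?_
  congr 1 with x
  rw [← mul_sub, norm_mul, norm_unitaryChar, one_mul]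

lemma norm_toLp_two_sq {α F : Type*} [MeasurableSpace α] [NormedAddCommGroup F] {μ : Measure α}
    {f : α → F} (hf : MemLp f 2 μ) : ‖hf.toLp f‖ ^ 2 = ∫ x, ‖f x‖ ^ 2 ∂μ := by
  have h0 : 0 ≤ ∫ x, ‖f x‖ ^ 2 ∂μ := integral_nonneg fun _ => by positivity
  rw [Lp.norm_toLp, hf.eLpNorm_eq_integral_rpow_norm (by norm_num) (by norm_num)]
  simp only [ENNReal.toReal_ofNat, Real.rpow_ofNat]
  rw [ENNReal.toReal_ofReal (by positivity), ← Real.rpow_natCast, ← Real.rpow_mul h0]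
  norm_num

lemma integral_norm_sub_le_of_mem_boundedSupportedIn {K : Set V} (hK : IsCompact K)
    {f g : BoundedContinuousFunction V ℂ} (hf : f ∈ boundedSupportedIn K)
    (hg : g ∈ boundedSupportedIn K) :
    ∫ x, ‖f x - g x‖ ≤ volume.real K * ‖f - g‖ := by
  have e : ∫ x, ‖f x - g x‖ = ∫ x in K, ‖f x - g x‖ := by
    refine (setIntegral_eq_integral_of_forall_compl_eq_zero fun x hx => ?_).symm
    rw [hf x hx, hg x hx, sub_zero, norm_zero]
  rw [e]
  refine (Real.le_norm_self _).trans ?_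
  rw [mul_comm]
  refine norm_setIntegral_le_of_norm_le_const hK.measure_lt_top fun x _ => ?_
  rw [norm_norm]
  exact (f - g).norm_coe_le_norm x

/-- If `𝓕 f ∈ L²(ν)` for all `f ∈ C_c`, then the `L²(ν)` norm of `𝓕 f` is bounded over all
translates of `𝓕 f`. -/
lemma exists_integral_norm_fourier_sub_sq_le {ν : Measure V}
    (hν : ∀ f : V → ℂ, Continuous f → HasCompactSupport f → Integrable (fun χ => ‖𝓕 f χ‖ ^ 2) ν)
    {f : V → ℂ} (hf : Continuous f) (hfc : HasCompactSupport f) :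
    ∃ M : ℝ, ∀ ξ, ∫ χ, ‖𝓕 f (χ - ξ)‖ ^ 2 ∂ν ≤ M := by
  set K := tsupport f with hKdef
  have hK : IsCompact K := hfc
  have hint : ∀ g : boundedSupportedIn K, Integrable (g : BoundedContinuousFunction V ℂ) :=
    fun g => g.1.continuous.integrable_of_hasCompactSupport
      (hasCompactSupport_of_mem_boundedSupportedIn hK g.2)
  have hmem : ∀ g : boundedSupportedIn K, MemLp (𝓕 (g.1 : V → ℂ)) 2 ν := fun g =>
    (memLp_two_iff_integrable_sq_norm
      (continuous_fourier_of_integrable (hint g)).aestronglyMeasurable).2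
      (hν _ g.1.continuous (hasCompactSupport_of_mem_boundedSupportedIn hK g.2))
  let T : boundedSupportedIn K →ₗ[ℂ] Lp ℂ 2 ν :=
    { toFun := fun g => (hmem g).toLp _
      map_add' := by
        intro g h
        rw [← MemLp.toLp_add]
        congr 1
        funext χ
        simp only [Pi.add_apply, fourier_eq_integral_unitaryChar]
        rw [← integral_add (integrable_unitaryChar_mul (hint g) _)
          (integrable_unitaryChar_mul (hint h) _)]
        congr 1 with x
        simp [mul_add]
      map_smul' := by
        intro c g
        rw [RingHom.id_apply, ← MemLp.toLp_const_smul]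
        congr 1
        funext χ
        simp only [Pi.smul_apply, fourier_eq_integral_unitaryChar]
        rw [smul_eq_mul, ← integral_const_mul]
        congr 1 with x
        simp
        ring }
  have : CompleteSpace (boundedSupportedIn K) :=
    (isClosed_boundedSupportedIn K).completeSpace_coe
  have hT : Continuous T := by
    -- Uniform convergence inside `K` gives pointwise convergence of the transforms, while `L²`
    -- convergence gives it almost everywhere along a subsequence; the limits must agree.
    refine T.continuous_of_seq_closed_graph fun u g y hu hy => ?_
    obtain ⟨ns, hns, hae⟩ := (tendstoInMeasure_of_tendsto_Lp hy).exists_seq_tendsto_ae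
    refine Lp.ext ?_
    have hTu : ∀ᵐ χ ∂ν, ∀ n, T (u n) χ = 𝓕 ((u n).1 : V → ℂ) χ :=
      ae_all_iff.2 fun n => (hmem (u n)).coeFn_toLp
    filter_upwards [hae, hTu, (hmem g).coeFn_toLp] with χ h1 h2 h3
    have h3' : T g χ = 𝓕 (g.1 : V → ℂ) χ := h3
    rw [h3']
    refine tendsto_nhds_unique h1 ?_
    simp only [Function.comp_apply, h2]
    have h4 : Tendsto (fun n => 𝓕 ((u n).1 : V → ℂ) χ) atTop (𝓝 (𝓕 (g.1 : V → ℂ) χ)) := by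
      rw [tendsto_iff_norm_sub_tendsto_zero]
      refine squeeze_zero (fun _ => norm_nonneg _) (fun n =>
        (norm_fourier_sub_le (hint (u n)) (hint g) χ).trans
          (integral_norm_sub_le_of_mem_boundedSupportedIn hK (u n).2 g.2)) ?_
      have h5 := (tendsto_iff_norm_sub_tendsto_zero.1 hu).const_mul (volume.real K)
      rw [mul_zero] at h5
      exact h5
    exact h4.comp hns.tendsto_atTop
  obtain ⟨B, hB⟩ := hfc.exists_bound_of_continuous hf
  have hB0 : 0 ≤ B := (norm_nonneg _).trans (hB 0)
  let T' : boundedSupportedIn K →L[ℂ] Lp ℂ 2 ν := ⟨T, hT⟩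
  refine ⟨(‖T'‖ * B) ^ 2, fun ξ => ?_⟩
  -- Translating `𝓕 f` modulates `f`, which changes neither its support nor its sup norm.
  let g : BoundedContinuousFunction V ℂ :=
    BoundedContinuousFunction.ofNormedAddCommGroup (fun x => unitaryChar ξ x * f x)
      ((continuous_unitaryChar ξ).mul hf) B
      (fun x => by rw [norm_mul, norm_unitaryChar, one_mul]; exact hB x)
  have hg : g ∈ boundedSupportedIn K := by
    intro x hx
    change unitaryChar ξ x * f x = 0
    rw [image_eq_zero_of_notMem_tsupport hx, mul_zero]
  have hgB : ‖g‖ ≤ B := BoundedContinuousFunction.norm_ofNormedAddCommGroup_le _ hB0 _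
  have h1 : ∫ χ, ‖𝓕 f (χ - ξ)‖ ^ 2 ∂ν = ‖T' ⟨g, hg⟩‖ ^ 2 := by
    refine Eq.trans ?_ (norm_toLp_two_sq (hmem ⟨g, hg⟩)).symm
    congr 1 with χ
    rw [← fourier_unitaryChar_mul]
    rfl
  rw [h1]
  gcongr
  refine (T'.le_opNorm _).trans ?_
  gcongr
  exact hgB

lemma exists_contDiff_integral_eq_one (V : Type*) [NormedAddCommGroup V] [InnerProductSpace ℝ V]
    [MeasurableSpace V] [BorelSpace V] [FiniteDimensional ℝ V] :
    ∃ φ : V → ℝ, ContDiff ℝ (⊤ : ℕ∞) φ ∧ HasCompactSupport φ ∧ (∀ x, 0 ≤ φ x) ∧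
      ∫ x, φ x = 1 := by
  let b : ContDiffBump (0 : V) := ⟨1, 2, by norm_num, by norm_num⟩
  exact ⟨b.normed volume, b.contDiff_normed, b.hasCompactSupport_normed, b.nonneg_normed,
    b.integral_normed⟩

lemma exists_norm_fourier_le {f : V → ℂ} (hf : ContDiff ℝ (⊤ : ℕ∞) f)
    (hfc : HasCompactSupport f) (k : ℕ) :
    ∃ C : ℝ, 0 < C ∧ ∀ χ, ‖𝓕 f χ‖ ≤ C * (1 + ‖χ‖) ^ (-(k : ℝ)) := by
  let s : SchwartzMap V ℂ := hfc.toSchwartzMap hf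
  obtain ⟨C, hC⟩ : ∃ C : ℝ, ∀ χ, (1 + ‖χ‖) ^ k * ‖𝓕 s χ‖ ≤ C := by
    have h := SchwartzMap.one_add_le_sup_seminorm_apply (𝕜 := ℝ) (m := (k, 0)) (k := k) (n := 0)
      le_rfl le_rfl (𝓕 s)
    simp only [norm_iteratedFDeriv_zero] at h
    exact ⟨_, h⟩
  refine ⟨max C 1, by positivity, fun χ => ?_⟩
  have h1 : (0 : ℝ) < 1 + ‖χ‖ := by positivity
  rw [Real.rpow_neg h1.le, Real.rpow_natCast, ← div_eq_mul_inv, le_div_iff₀ (by positivity),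
    mul_comm]
  exact (hC χ).trans (le_max_left _ _)

/-- Replace `g` at each point by its values on the surrounding ball, at the cost of `a`, and
exchange integrals by Tonelli: the inner integral becomes the `ν`-mass of a ball. -/
lemma lintegral_comp_sub_mul_le {ν : Measure V} [SFinite ν] {g : V → ENNReal}
    (hg : Measurable g) {r : ℝ} {c : ENNReal} (hc : ∀ y, ν (Metric.ball y r) ≤ c) {a : ENNReal}
    (ha : ∀ x y, dist x y < r → g x ≤ a * g y) (ξ : V) :
    (∫⁻ χ, g (χ - ξ) ∂ν) * volume (Metric.ball (0 : V) r) ≤ a * c * ∫⁻ y, g y := by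
  have hset : MeasurableSet {p : V × V | dist p.1 p.2 < r} :=
    (isOpen_lt (by fun_prop) continuous_const).measurableSet
  let G : V → V → ENNReal := fun χ y =>
    {p : V × V | dist p.1 p.2 < r}.indicator (fun p => a * g (p.2 - ξ)) (χ, y)
  have hG : Measurable (Function.uncurry G) := by
    refine Measurable.indicator ?_ hset
    fun_prop
  have hgm : Measurable fun χ : V => g (χ - ξ) := by fun_prop
  calc (∫⁻ χ, g (χ - ξ) ∂ν) * volume (Metric.ball (0 : V) r)
      = ∫⁻ χ, g (χ - ξ) * volume (Metric.ball (0 : V) r) ∂ν :=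
        (lintegral_mul_const _ hgm).symm
    _ ≤ ∫⁻ χ, (∫⁻ y, G χ y) ∂ν := by
        refine lintegral_mono fun χ => ?_
        rw [← Measure.addHaar_ball_center volume χ r, ← setLIntegral_const,
          ← lintegral_indicator Metric.isOpen_ball.measurableSet]
        refine lintegral_mono fun y => ?_
        by_cases hy : dist y χ < r
        · have hy' : dist χ y < r := by rwa [dist_comm]
          simp only [G, Set.indicator, Metric.mem_ball, Set.mem_ofPred_eq, hy, hy', if_true]
          exact ha _ _ (by simpa using hy')
        · simp [Set.indicator, Metric.mem_ball, hy]
    _ = ∫⁻ y, ∫⁻ χ, G χ y ∂ν := lintegral_lintegral_swap hG.aemeasurable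
    _ ≤ ∫⁻ y, a * c * g (y - ξ) := by
        refine lintegral_mono fun y => ?_
        have e : ∀ χ, G χ y = (Metric.ball y r).indicator (fun _ => a * g (y - ξ)) χ := by
          intro χ
          simp [G, Set.indicator, Metric.mem_ball]
        simp_rw [e]
        rw [lintegral_indicator Metric.isOpen_ball.measurableSet, setLIntegral_const]
        calc a * g (y - ξ) * ν (Metric.ball y r) ≤ a * g (y - ξ) * c := by gcongr; exact hc y
          _ = _ := by ring
    _ = a * c * ∫⁻ y, g (y - ξ) := lintegral_const_mul _ hgm
    _ = a * c * ∫⁻ y, g y := by rw [lintegral_sub_right_eq_self]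

/-- A bump of integral 1 has `|𝓕 f|² > 1/2` near 0, so Markov's inequality for its translates bounds
the mass of balls. The radius is capped at 1 for the later comparison of weights. -/
lemma exists_measure_ball_le {ν : Measure V}
    (hν : ∀ f : V → ℂ, Continuous f → HasCompactSupport f → Integrable (fun χ => ‖𝓕 f χ‖ ^ 2) ν) :
    ∃ r : ℝ, 0 < r ∧ r ≤ 1 ∧ ∃ c : ENNReal, c ≠ ⊤ ∧ ∀ y, ν (Metric.ball y r) ≤ c := by
  obtain ⟨φ, hφ, hφc, -, hφ1⟩ := exists_contDiff_integral_eq_one V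
  set f : V → ℂ := fun x => (φ x : ℂ) with hf
  have hfcont : Continuous f := Complex.continuous_ofReal.comp hφ.continuous
  have hfc : HasCompactSupport f := hφc.comp_left (g := ((↑) : ℝ → ℂ)) Complex.ofReal_zero
  have hfi : Integrable f := hfcont.integrable_of_hasCompactSupport hfc
  have hF := continuous_fourier_of_integrable hfi
  have hF0 : 𝓕 f 0 = 1 := by
    rw [fourier_eq_integral_unitaryChar]
    simp only [neg_zero, unitaryChar_zero, one_mul, hf]
    rw [integral_complex_ofReal, hφ1, Complex.ofReal_one]
  obtain ⟨M, hM⟩ := exists_integral_norm_fourier_sub_sq_le hν hfcont hfc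
  have hev : ∀ᶠ χ in 𝓝 (0 : V), 1 / 2 < ‖𝓕 f χ‖ ^ 2 := by
    have : Tendsto (fun χ => ‖𝓕 f χ‖ ^ 2) (𝓝 0) (𝓝 (‖𝓕 f 0‖ ^ 2)) :=
      ((hF.norm.pow 2).tendsto 0)
    exact this.eventually_const_lt (by rw [hF0]; norm_num)
  obtain ⟨r, hr, hball⟩ := Metric.eventually_nhds_iff_ball.1 hev
  refine ⟨min r 1, by positivity, min_le_right _ _, ENNReal.ofReal (2 * M),
    ENNReal.ofReal_ne_top, fun y => ?_⟩
  have hint : Integrable (fun χ => ‖𝓕 f (χ - y)‖ ^ 2) ν := by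
    have h := hν (fun x => unitaryChar y x * f x) ((continuous_unitaryChar y).mul hfcont)
      hfc.mul_left
    simpa only [fourier_unitaryChar_mul] using h
  have h1 : ∫⁻ χ, ENNReal.ofReal (‖𝓕 f (χ - y)‖ ^ 2) ∂ν ≤ ENNReal.ofReal M := by
    rw [← ofReal_integral_eq_lintegral_ofReal hint (ae_of_all _ fun _ => by positivity)]
    exact ENNReal.ofReal_le_ofReal (hM y)
  have h2 : ENNReal.ofReal (1 / 2) * ν (Metric.ball y (min r 1)) ≤ ENNReal.ofReal M := by
    refine le_trans ?_ ((mul_meas_ge_le_lintegral₀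
      hint.1.aemeasurable.ennreal_ofReal (ENNReal.ofReal (1 / 2))).trans h1)
    gcongr
    intro χ hχ
    refine ENNReal.ofReal_le_ofReal (hball _ ?_).le
    rw [Metric.mem_ball, dist_zero_right, ← dist_eq_norm]
    exact (Metric.mem_ball.1 hχ).trans_le (min_le_left _ _)
  calc ν (Metric.ball y (min r 1))
      = ENNReal.ofReal 2 * (ENNReal.ofReal (1 / 2) * ν (Metric.ball y (min r 1))) := by
        rw [← mul_assoc, ← ENNReal.ofReal_mul (by norm_num)]
        norm_num
    _ ≤ ENNReal.ofReal 2 * ENNReal.ofReal M := by gcongr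
    _ = ENNReal.ofReal (2 * M) := (ENNReal.ofReal_mul (by norm_num)).symm

/-- Translates of an integrable power of `1 + ‖χ‖` have bounded integrals with respect to a measure
`ν` for which `𝓕` maps `C_c` to `L²(ν)`. -/
lemma exists_integral_one_add_norm_sub_le {ν : Measure V} [SFinite ν]
    (hν : ∀ f : V → ℂ, Continuous f → HasCompactSupport f → Integrable (fun χ => ‖𝓕 f χ‖ ^ 2) ν)
    {k : ℕ} (hk : Module.finrank ℝ V < k) :
    ∃ M : ℝ, ∀ ξ, Integrable (fun χ => (1 + ‖χ - ξ‖) ^ (-(k : ℝ))) ν ∧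
      ∫ χ, (1 + ‖χ - ξ‖) ^ (-(k : ℝ)) ∂ν ≤ M := by
  obtain ⟨r, hr, hr1, c, hc, hball⟩ := exists_measure_ball_le hν
  let g : V → ENNReal := fun χ => ENNReal.ofReal ((1 + ‖χ‖) ^ (-(k : ℝ)))
  have hg : Measurable g := by
    refine ENNReal.measurable_ofReal.comp ?_
    fun_prop
  have hgint : ∫⁻ y, g y ≠ ⊤ := by
    have h := integrable_one_add_norm (E := V) (μ := volume) (r := (k : ℝ)) (by exact_mod_cast hk)
    have h2 := ofReal_integral_eq_lintegral_ofReal h (ae_of_all _ fun _ => by positivity)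
    rw [← h2]
    exact ENNReal.ofReal_ne_top
  have ha : ∀ x y, dist x y < r → g x ≤ ENNReal.ofReal (2 ^ k) * g y := by
    intro x y hxy
    simp only [g]
    rw [← ENNReal.ofReal_mul (by positivity)]
    refine ENNReal.ofReal_le_ofReal ?_
    rw [Real.rpow_neg (by positivity), Real.rpow_neg (by positivity), Real.rpow_natCast,
      Real.rpow_natCast, ← div_eq_mul_inv, inv_eq_one_div,
      div_le_div_iff₀ (by positivity) (by positivity), one_mul, ← mul_pow]
    gcongr
    have h1 : ‖y‖ ≤ ‖x‖ + dist x y := by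
      rw [dist_comm, dist_eq_norm]
      linarith [norm_sub_norm_le y x]
    linarith [norm_nonneg x]
  set B : ENNReal := ENNReal.ofReal (2 ^ k) * c * ∫⁻ y, g y with hB
  have hBtop : B ≠ ⊤ := ENNReal.mul_ne_top (ENNReal.mul_ne_top ENNReal.ofReal_ne_top hc) hgint
  have hv0 : volume (Metric.ball (0 : V) r) ≠ 0 := (Metric.measure_ball_pos volume 0 hr).ne'
  have hvt : volume (Metric.ball (0 : V) r) ≠ ⊤ := measure_ball_lt_top.ne
  have hD : B / volume (Metric.ball (0 : V) r) ≠ ⊤ := ENNReal.div_ne_top hBtop hv0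
  have key : ∀ ξ, ∫⁻ χ, g (χ - ξ) ∂ν ≤ B / volume (Metric.ball (0 : V) r) := by
    intro ξ
    rw [ENNReal.le_div_iff_mul_le (Or.inl hv0) (Or.inl hvt)]
    exact lintegral_comp_sub_mul_le hg hball ha ξ
  refine ⟨(B / volume (Metric.ball (0 : V) r)).toReal, fun ξ => ?_⟩
  have hmeas : AEStronglyMeasurable (fun χ => (1 + ‖χ - ξ‖) ^ (-(k : ℝ))) ν :=
    Measurable.aestronglyMeasurable (by fun_prop)
  have hnn : ∀ χ : V, 0 ≤ (1 + ‖χ - ξ‖) ^ (-(k : ℝ)) := fun χ => by positivity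
  refine ⟨?_, ?_⟩
  · refine (lintegral_ofReal_ne_top_iff_integrable hmeas (ae_of_all _ hnn)).1 ?_
    exact ne_top_of_le_ne_top hD (key ξ)
  · rw [integral_eq_lintegral_of_nonneg_ae (ae_of_all _ hnn) hmeas]
    exact ENNReal.toReal_mono hD (key ξ)

end TranslationBounded

/-! ### Comparison with the duality pairing -/

section DualChar

variable {d : ℕ}

lemma norm_unitaryChar_sub_one (ψ x : EuclideanSpace ℝ (Fin d)) :
    ‖unitaryChar ψ x - 1‖ = ‖1 - dualChar ψ x‖ := by
  have e : unitaryChar ψ x - 1 = -conj (1 - dualChar ψ x) := by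
    have h : dualChar ψ x = unitaryChar (-ψ) x := by
      rw [dualChar, unitaryChar, inner_neg_right]
      push_cast
      ring_nf
    rw [h, map_sub, conj_unitaryChar, neg_neg, map_one]
    ring
  rw [e, norm_neg, RCLike.norm_conj]

end DualChar

/-! ### Autocorrelations `f * f~` -/

section AutoConv

variable {d : ℕ}

lemma autoConv_apply (f : EuclideanSpace ℝ (Fin d) → ℂ) (x : EuclideanSpace ℝ (Fin d)) :
    autoConv f x = ∫ t, f t * conj (f (-(x - t))) := rfl

lemma autoConv_unitaryChar_mul (f : EuclideanSpace ℝ (Fin d) → ℂ)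
    (ξ x : EuclideanSpace ℝ (Fin d)) :
    autoConv (fun y => unitaryChar ξ y * f y) x = unitaryChar ξ x * autoConv f x := by
  rw [autoConv_apply, autoConv_apply, ← integral_const_mul]
  congr 1 with t
  have h : unitaryChar ξ x = unitaryChar ξ t * unitaryChar ξ (x - t) := by
    rw [unitaryChar_sub_right, conj_unitaryChar]
    have h2 : unitaryChar ξ t * unitaryChar (-ξ) t = 1 := by
      rw [← unitaryChar_add, add_neg_cancel, unitaryChar_zero]
    linear_combination -unitaryChar ξ x * h2
  have h3 : conj (unitaryChar ξ (-(x - t))) = unitaryChar ξ (x - t) := by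
    rw [conj_unitaryChar]
    simp only [unitaryChar, inner_neg_left, inner_neg_right, neg_neg]
  rw [map_mul, h3, h]
  ring

lemma hasCompactSupport_conj_neg {f : EuclideanSpace ℝ (Fin d) → ℂ} (hfc : HasCompactSupport f) :
    HasCompactSupport fun x => conj (f (-x)) :=
  (hfc.comp_homeomorph (Homeomorph.neg _)).comp_left (g := conj) (map_zero _)

lemma continuous_autoConv {f : EuclideanSpace ℝ (Fin d) → ℂ} (hf : Continuous f)
    (hfc : HasCompactSupport f) : Continuous (autoConv f) :=
  (hasCompactSupport_conj_neg hfc).continuous_convolution_right _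
    hf.locallyIntegrable (by fun_prop)

lemma hasCompactSupport_autoConv {f : EuclideanSpace ℝ (Fin d) → ℂ}
    (hfc : HasCompactSupport f) : HasCompactSupport (autoConv f) :=
  HasCompactSupport.convolution _ hfc (hasCompactSupport_conj_neg hfc)

/-- Positivity of the weights is what yields the sharp constant for positive `η`. -/
lemma autoConv_ofReal_eq_norm {f : EuclideanSpace ℝ (Fin d) → ℝ} (hf : ∀ x, 0 ≤ f x)
    (x : EuclideanSpace ℝ (Fin d)) :
    autoConv (fun y => (f y : ℂ)) x = (‖autoConv (fun y => (f y : ℂ)) x‖ : ℝ) := by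
  have h : autoConv (fun y => (f y : ℂ)) x = ((∫ t, f t * f (-(x - t)) : ℝ) : ℂ) := by
    rw [autoConv_apply, ← integral_complex_ofReal]
    congr 1 with t
    simp
  have h0 : 0 ≤ ∫ t, f t * f (-(x - t)) := integral_nonneg fun t => mul_nonneg (hf _) (hf _)
  rw [h, Complex.norm_real, Real.norm_of_nonneg h0]

end AutoConv

/-! ### Dilations -/

section ApproximateIdentity

variable {V : Type*} [NormedAddCommGroup V] [InnerProductSpace ℝ V]

/-- The `L¹`-normalised dilation `x ↦ a^{-d} φ(x / a)`. -/
noncomputable def dilate (φ : V → ℝ) (a : ℝ) (x : V) : ℝ :=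
  (a ^ Module.finrank ℝ V)⁻¹ * φ (a⁻¹ • x)

lemma continuous_dilate {φ : V → ℝ} (hφ : Continuous φ) (a : ℝ) : Continuous (dilate φ a) := by
  unfold dilate
  fun_prop

lemma hasCompactSupport_dilate {φ : V → ℝ} (hφ : HasCompactSupport φ) {a : ℝ} (ha : 0 < a) :
    HasCompactSupport (dilate φ a) :=
  (hφ.comp_homeomorph (Homeomorph.smulOfNeZero a⁻¹ (inv_ne_zero ha.ne'))).mul_left

lemma dilate_nonneg {φ : V → ℝ} (hφ : ∀ x, 0 ≤ φ x) {a : ℝ} (ha : 0 < a) (x : V) :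
    0 ≤ dilate φ a x :=
  mul_nonneg (by positivity) (hφ _)

lemma fourier_dilate [MeasurableSpace V] [BorelSpace V] [FiniteDimensional ℝ V] (φ : V → ℝ) {a : ℝ} (ha : 0 < a)
    (χ : V) :
    𝓕 (fun x => (dilate φ a x : ℂ)) χ = 𝓕 (fun x => (φ x : ℂ)) (a • χ) := by
  rw [fourier_eq_integral_unitaryChar, fourier_eq_integral_unitaryChar]
  have e : ∀ x : V, unitaryChar (-χ) x * (dilate φ a x : ℂ) =
      (((a ^ Module.finrank ℝ V)⁻¹ : ℝ) : ℂ) *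
        (fun y => unitaryChar (-(a • χ)) y * (φ y : ℂ)) (a⁻¹ • x) := by
    intro x
    have h : unitaryChar (-(a • χ)) (a⁻¹ • x) = unitaryChar (-χ) x := by
      simp only [unitaryChar, inner_neg_right, inner_smul_left, inner_smul_right]
      simp [ha.ne']
    simp only [h, dilate]
    push_cast
    ring
  simp_rw [e]
  rw [integral_const_mul, Measure.integral_comp_inv_smul volume
    (fun y => unitaryChar (-(a • χ)) y * (φ y : ℂ)), abs_of_pos (by positivity),
    Complex.real_smul, ← mul_assoc, ← Complex.ofReal_mul, inv_mul_cancel₀ (by positivity),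
    Complex.ofReal_one, one_mul]

end ApproximateIdentity

/-! ### Recovering atoms of the transform, and the theorem -/

section FourierTransformable

open Filter Topology

variable {d : ℕ} {η ν : ComplexRadonMeasure (EuclideanSpace ℝ (Fin d))}

lemma IsFourierTransform.integral_unitaryChar_mul_autoConv (hη : IsFourierTransform η ν)
    {f : EuclideanSpace ℝ (Fin d) → ℂ} (hf : Continuous f) (hfc : HasCompactSupport f)
    (ξ : EuclideanSpace ℝ (Fin d)) :
    η.integral (fun x => unitaryChar ξ x * autoConv f x) =
      ν.integral (fun χ => ((‖𝓕 f (χ - ξ)‖ ^ 2 : ℝ) : ℂ)) := by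
  have h := (hη (fun x => unitaryChar ξ x * f x) ((continuous_unitaryChar ξ).mul hf)
    hfc.mul_left).2
  simp only [fourier_unitaryChar_mul] at h
  rw [← h]
  congr 1 with x
  rw [autoConv_unitaryChar_mul]

lemma ComplexRadonMeasure.integrable_mul_phase {E : Type*} [TopologicalSpace E]
    [MeasurableSpace E] (μ : ComplexRadonMeasure E) {f : E → ℂ} (hf : Integrable f μ.variation) :
    Integrable (fun x => f x * μ.phase x) μ.variation :=
  hf.mul_bdd (c := 1) μ.measurable_phase.aestronglyMeasurable
    (ae_of_all _ fun x => (μ.norm_phase x).le)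

/-- The integrands are 1 at `ξ` and decay to 0 elsewhere. Since the dilation factor is at least 1,
one translated power of `1 + ‖χ‖` dominates them all, with integral bounded independently of `ξ`. -/
lemma tendsto_integral_norm_fourier_smul_sub (hη : IsFourierTransform η ν)
    {φ : EuclideanSpace ℝ (Fin d) → ℝ} (hφ : ContDiff ℝ (⊤ : ℕ∞) φ) (hφc : HasCompactSupport φ)
    (hφ1 : ∫ x, φ x = 1) :
    (∃ S : ℝ, ∀ (n : ℕ) ξ, ‖ν.integral (fun χ =>
        ((‖𝓕 (fun x => (φ x : ℂ)) (((n : ℝ) + 1) • (χ - ξ))‖ ^ 2 : ℝ) : ℂ))‖ ≤ S) ∧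
      ∀ ξ, Tendsto (fun n : ℕ => ν.integral (fun χ =>
        ((‖𝓕 (fun x => (φ x : ℂ)) (((n : ℝ) + 1) • (χ - ξ))‖ ^ 2 : ℝ) : ℂ)))
        atTop (𝓝 (ν.measureOf {ξ})) := by
  have := ν.locallyFinite
  set F : EuclideanSpace ℝ (Fin d) → ℂ := 𝓕 (fun x => (φ x : ℂ)) with hFdef
  have hfcont : ContDiff ℝ (⊤ : ℕ∞) fun x => (φ x : ℂ) := Complex.ofRealCLM.contDiff.comp hφ
  have hfc : HasCompactSupport fun x => (φ x : ℂ) :=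
    hφc.comp_left (g := ((↑) : ℝ → ℂ)) Complex.ofReal_zero
  have hF : Continuous F :=
    continuous_fourier_of_integrable (hfcont.continuous.integrable_of_hasCompactSupport hfc)
  have hF0 : F 0 = 1 := by
    rw [hFdef, fourier_eq_integral_unitaryChar]
    simp only [neg_zero, unitaryChar_zero, one_mul]
    rw [integral_complex_ofReal, hφ1, Complex.ofReal_one]
  set k := Module.finrank ℝ (EuclideanSpace ℝ (Fin d)) + 1 with hk
  obtain ⟨C, hC0, hC⟩ := exists_norm_fourier_le hfcont hfc k
  obtain ⟨M, hM⟩ := exists_integral_one_add_norm_sub_le (fun f hf hfc => (hη f hf hfc).1)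
    (Nat.lt_succ_self _ : Module.finrank ℝ (EuclideanSpace ℝ (Fin d)) < k)
  have hsq : ∀ χ, ‖F χ‖ ^ 2 ≤ C ^ 2 * (1 + ‖χ‖) ^ (-(k : ℝ)) := by
    intro χ
    have h1 : (1 + ‖χ‖) ^ (-(k : ℝ)) ≤ 1 :=
      Real.rpow_le_one_of_one_le_of_nonpos (by linarith [norm_nonneg χ])
        (neg_nonpos.2 (Nat.cast_nonneg _))
    have h2 : 0 ≤ (1 + ‖χ‖) ^ (-(k : ℝ)) := by positivity
    calc ‖F χ‖ ^ 2 ≤ (C * (1 + ‖χ‖) ^ (-(k : ℝ))) ^ 2 := by gcongr; exact hC χ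
      _ = C ^ 2 * ((1 + ‖χ‖) ^ (-(k : ℝ)) * (1 + ‖χ‖) ^ (-(k : ℝ))) := by ring
      _ ≤ C ^ 2 * (1 * (1 + ‖χ‖) ^ (-(k : ℝ))) := by gcongr
      _ = _ := by rw [one_mul]
  have hdom : ∀ (n : ℕ) (χ : EuclideanSpace ℝ (Fin d)),
      ‖F (((n : ℝ) + 1) • χ)‖ ^ 2 ≤ C ^ 2 * (1 + ‖χ‖) ^ (-(k : ℝ)) := by
    intro n χ
    refine (hsq _).trans (mul_le_mul_of_nonneg_left ?_ (sq_nonneg C))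
    refine Real.rpow_le_rpow_of_nonpos (by positivity) ?_ (neg_nonpos.2 (Nat.cast_nonneg _))
    rw [norm_smul, Real.norm_of_nonneg (by positivity)]
    gcongr
    exact le_mul_of_one_le_left (norm_nonneg _) (by linarith [(Nat.cast_nonneg n : (0 : ℝ) ≤ n)])
  have hbound : ∀ (n : ℕ) (ξ χ : EuclideanSpace ℝ (Fin d)),
      ‖((‖F (((n : ℝ) + 1) • (χ - ξ))‖ ^ 2 : ℝ) : ℂ) * ν.phase χ‖ ≤
        C ^ 2 * (1 + ‖χ - ξ‖) ^ (-(k : ℝ)) := by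
    intro n ξ χ
    rw [norm_mul, ν.norm_phase, mul_one, Complex.norm_real, Real.norm_of_nonneg (by positivity)]
    exact hdom n _
  refine ⟨⟨C ^ 2 * M, fun n ξ => ?_⟩, fun ξ => ?_⟩
  · refine (norm_integral_le_of_norm_le ((hM ξ).1.const_mul (C ^ 2))
      (ae_of_all _ (hbound n ξ))).trans ?_
    rw [integral_const_mul]
    exact mul_le_mul_of_nonneg_left (hM ξ).2 (by positivity)
  · have hlim : ν.measureOf {ξ} =
        ∫ χ, ({ξ} : Set (EuclideanSpace ℝ (Fin d))).indicator ν.phase χ ∂ν.variation :=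
      (integral_indicator (measurableSet_singleton ξ)).symm
    rw [hlim]
    refine tendsto_integral_of_dominated_convergence _ (fun n => ?_)
      ((hM ξ).1.const_mul (C ^ 2)) (fun n => ae_of_all _ (hbound n ξ)) (ae_of_all _ fun χ => ?_)
    · exact (Continuous.aestronglyMeasurable (by fun_prop)).mul
        ν.measurable_phase.aestronglyMeasurable
    · by_cases hχ : χ = ξ
      · subst hχ
        simp [hF0]
      · rw [Set.indicator_of_notMem (by simpa using hχ)]
        have hpos : 0 < ‖χ - ξ‖ := norm_pos_iff.2 (sub_ne_zero.2 hχ)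
        have hT : Tendsto (fun n : ℕ => 1 + ((n : ℝ) + 1) * ‖χ - ξ‖) atTop atTop :=
          tendsto_atTop_add_const_left _ _
            ((tendsto_atTop_add_const_right _ _ tendsto_natCast_atTop_atTop).atTop_mul_const hpos)
        have hT2 := ((tendsto_rpow_neg_atTop (y := (k : ℝ))
          (by rw [hk]; positivity)).comp hT).const_mul (C ^ 2)
        rw [mul_zero] at hT2
        refine squeeze_zero_norm (fun n => ?_) hT2
        rw [norm_mul, ν.norm_phase, mul_one, Complex.norm_real,
          Real.norm_of_nonneg (by positivity)]
        refine (hsq _).trans_eq ?_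
        rw [norm_smul, Real.norm_of_nonneg (by positivity)]
        rfl

/-- Averaging `η` against nonnegative test functions recovers the atoms of its Fourier
transform. -/
lemma IsFourierTransform.exists_tendsto_measureOf_singleton (hη : IsFourierTransform η ν) :
    ∃ F : ℕ → EuclideanSpace ℝ (Fin d) → ℂ,
      (∀ n, Integrable (F n) η.variation) ∧ (∀ n x, F n x = (‖F n x‖ : ℝ)) ∧
      (∃ S : ℝ, ∀ n ξ, ‖η.integral (fun x => unitaryChar ξ x * F n x)‖ ≤ S) ∧
      ∀ ξ, Tendsto (fun n => η.integral (fun x => unitaryChar ξ x * F n x)) atTop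
        (𝓝 (ν.measureOf {ξ})) := by
  have := η.locallyFinite
  obtain ⟨φ, hφ, hφc, hφ0, hφ1⟩ := exists_contDiff_integral_eq_one (EuclideanSpace ℝ (Fin d))
  have hpos : ∀ n : ℕ, (0 : ℝ) < (n : ℝ) + 1 := fun n => by positivity
  let f : ℕ → EuclideanSpace ℝ (Fin d) → ℂ := fun n x => (dilate φ ((n : ℝ) + 1) x : ℂ)
  have hf : ∀ n, Continuous (f n) := fun n =>
    Complex.continuous_ofReal.comp (continuous_dilate hφ.continuous _)
  have hfc : ∀ n, HasCompactSupport (f n) := fun n =>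
    (hasCompactSupport_dilate hφc (hpos n)).comp_left (g := ((↑) : ℝ → ℂ)) Complex.ofReal_zero
  have key : ∀ n ξ, η.integral (fun x => unitaryChar ξ x * autoConv (f n) x) =
      ν.integral (fun χ =>
        ((‖𝓕 (fun x => (φ x : ℂ)) (((n : ℝ) + 1) • (χ - ξ))‖ ^ 2 : ℝ) : ℂ)) := by
    intro n ξ
    rw [hη.integral_unitaryChar_mul_autoConv (hf n) (hfc n) ξ]
    congr 1 with χ
    rw [fourier_dilate φ (hpos n)]
  obtain ⟨⟨S, hS⟩, hlim⟩ := tendsto_integral_norm_fourier_smul_sub hη hφ hφc hφ1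
  refine ⟨fun n => autoConv (f n), fun n => ?_, fun n x => ?_, ⟨S, fun n ξ => ?_⟩, fun ξ => ?_⟩
  · exact (continuous_autoConv (hf n) (hfc n)).integrable_of_hasCompactSupport
      (hasCompactSupport_autoConv (hfc n))
  · exact autoConv_ofReal_eq_norm (dilate_nonneg hφ0 (hpos n)) x
  · rw [key]
    exact hS n ξ
  · simp_rw [key]
    exact hlim ξ

lemma ae_norm_unitaryChar_sub_one_le {Δ : Set (EuclideanSpace ℝ (Fin d))} (hΔ : η.supp ⊆ Δ)
    {ε : ℝ} {ψ : EuclideanSpace ℝ (Fin d)} (hψ : ψ ∈ epsDual Δ ε) :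
    ∀ᵐ x ∂η.variation, ‖unitaryChar ψ x - 1‖ ≤ ε := by
  filter_upwards [Measure.support_mem_ae (μ := η.variation)] with x hx
  rw [norm_unitaryChar_sub_one]
  exact hψ x (hΔ hx)

end FourierTransformable

theorem theorem3p1 (d : ℕ) (η ηhat : ComplexRadonMeasure (EuclideanSpace ℝ (Fin d)))
    (hη : IsFourierTransform η ηhat) (Δ : Set (EuclideanSpace ℝ (Fin d))) (hΔ : η.supp ⊆ Δ) :
    (∃ C : ℝ, 0 ≤ C ∧
      ∀ ε : ℝ, 0 < ε → ∀ χ : EuclideanSpace ℝ (Fin d), ∀ ψ ∈ epsDual Δ ε,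
        ‖ηhat.measureOf {ψ + χ} - ηhat.measureOf {χ}‖ ≤ C * ε) ∧
    (η.IsPositive →
      ∃ C : ℝ, 0 ≤ C ∧ (C : ℂ) = ηhat.measureOf {0} ∧
        ∀ ε : ℝ, 0 < ε → ∀ χ : EuclideanSpace ℝ (Fin d), ∀ ψ ∈ epsDual Δ ε,
          ‖ηhat.measureOf {ψ + χ} - ηhat.measureOf {χ}‖ ≤ C * ε) := by
  obtain ⟨F, hFint, hF0, ⟨S, hS⟩, hlim⟩ := hη.exists_tendsto_measureOf_singleton
  have hw : ∀ n, Integrable (fun x => F n x * η.phase x) η.variation := fun n =>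
    η.integrable_mul_phase (hFint n)
  have hint : ∀ n ξ, η.integral (fun x => unitaryChar ξ x * F n x) =
      ∫ x, unitaryChar ξ x * (F n x * η.phase x) ∂η.variation := by
    intro n ξ
    simp only [ComplexRadonMeasure.integral, mul_assoc]
  have hdiff : ∀ n ψ χ, η.integral (fun x => unitaryChar (ψ + χ) x * F n x) -
      η.integral (fun x => unitaryChar χ x * F n x) =
      ∫ x, (unitaryChar ψ x - 1) * (unitaryChar χ x * (F n x * η.phase x)) ∂η.variation := by
    intro n ψ χ
    rw [hint, hint, ← integral_sub (integrable_unitaryChar_mul (hw n) _)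
      (integrable_unitaryChar_mul (hw n) _)]
    congr 1 with x
    rw [unitaryChar_add]
    ring
  have hlimdiff := fun ψ χ => ((hlim (ψ + χ)).sub (hlim χ)).norm
  simp_rw [hdiff] at hlimdiff
  have hS' : ∀ n ξ, ‖∫ x, unitaryChar ξ x * (F n x * η.phase x) ∂η.variation‖ ≤ S := fun n ξ => by
    rw [← hint]
    exact hS n ξ
  have hS0 : 0 ≤ S := (norm_nonneg _).trans (hS 0 0)
  refine ⟨⟨2 * (Real.exp 8 - 1) * S, ?_, fun ε hε χ ψ hψ => ?_⟩, fun hpos => ?_⟩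
  · have : 1 ≤ Real.exp 8 := Real.one_le_exp (by norm_num)
    exact mul_nonneg (by linarith) hS0
  · exact le_of_tendsto (hlimdiff ψ χ) (Filter.Eventually.of_forall fun n =>
      norm_integral_unitaryChar_sub_one_mul_le (hw n) (hS' n) hε ψ
        (ae_norm_unitaryChar_sub_one_le hΔ hψ) χ)
  · have hreal : ∀ n, η.integral (fun x => unitaryChar 0 x * F n x) =
        ((∫ x, ‖F n x‖ ∂η.variation : ℝ) : ℂ) := by
      intro n
      rw [hint, ← integral_complex_ofReal]
      refine integral_congr_ae ?_
      filter_upwards [hpos] with x hx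
      rw [unitaryChar_zero, one_mul, hx, mul_one]
      exact hF0 n x
    have hlim0 := hlim 0
    simp_rw [hreal] at hlim0
    have hre := (Complex.continuous_re.tendsto _).comp hlim0
    simp only [Function.comp_def, Complex.ofReal_re] at hre
    have hofReal := (Complex.continuous_ofReal.tendsto _).comp hre
    refine ⟨(ηhat.measureOf {0}).re,
      ge_of_tendsto' hre fun n => integral_nonneg fun _ => norm_nonneg _,
      tendsto_nhds_unique hofReal hlim0, fun ε hε χ ψ hψ => ?_⟩
    -- Compare before the limit: the difference is at most `ε ∫ |F n| dη`, and these masses converge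
    -- to the atom at 0.
    refine le_of_tendsto_of_tendsto' (hlimdiff ψ χ) (hre.mul_const ε) fun n => ?_
    rw [← integral_mul_const]
    refine norm_integral_le_of_norm_le ((hFint n).norm.mul_const ε) ?_
    filter_upwards [ae_norm_unitaryChar_sub_one_le hΔ hψ] with x hx
    rw [norm_mul, norm_mul, norm_mul, norm_unitaryChar, η.norm_phase, one_mul, mul_one, mul_comm]
    gcongr
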